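/- Let $\mathbb K$ be a field, $n\ge 0$ and $a_1,\dots,a_n\ge 0$ integers, and let $\Delta$ be a simplicial complex on $\{1,\dots,n\}$, that is, a collection of subsets of $\{1,\dots,n\}$ such that $\mathcal J'\subseteq\mathcal J\in\Delta$ implies $\mathcal J'\in\Delta$ (so $\emptyset\in\Delta$ unless $\Delta$ has no members). The facets of $\Delta$ are its inclusion-maximal members. Let $S_\Delta$ be the polynomial ring over $\mathbb K$ with one variable $X_{i_1,\dots,i_n}$ for every $\mathcal J\in\Delta$ and every sequence $(i_1,\dots,i_n)$ with $i_j\in\{1,\dots,a_j\}$ for $j\in\mathcal J$ and $i_j=\bullet$ for $j\notin\mathcal J$. Consider the $\mathbb K$-algebra homomorphisms \begin{itemize} \item $\tau_\Delta\colon S_\Delta\to \mathbb K[x_{c_1,\dots,c_n}\mid 1\le c_j\le a_j]$, which sends $X_{i_1,\dots,i_n}$ to $\sum x_{c_1,\dots,c_n}$, the sum over all $(c_1,\dots,c_n)$ with $c_j=i_j$ whenever $i_j\neq\bullet$; \item $\sigma_\Delta\colon S_\Delta\to\mathbb K[y_{j,i}\mid 1\le j\le n,\ 1\le i\le a_j]$,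 the composite of $\tau_\Delta$ with the Segre map $x_{c_1,\dots,c_n}\mapsto\prod_{j=1}^n y_{j,c_j}$; \item $\eta_\Delta\colon S_\Delta\to\mathbb K[y_{j,i}\mid 1\le j\le n,\ 1\le i\le a_j\text{ or }i=\bullet]$, $X_{i_1,\dots,i_n}\mapsto\prod_{j=1}^n y_{j,i_j}$; \end{itemize} and put $K_\Delta=\ker\tau_\Delta$, $Q_\Delta=\ker\eta_\Delta$, $P_\Delta=\ker\sigma_\Delta$. If $\Delta$ has at most three facets, then the ideal $K_\Delta+Q_\Delta$ of $S_\Delta$ is radical, and $K_\Delta+Q_\Delta=P_\Delta$, which is a prime ideal. -/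

import Mathlib

namespace MarginTables

noncomputable section

open MvPolynomial

/-- The facets (inclusion-maximal faces) of a collection `Δ` of subsets of `Fin n`. -/
def facets {n : ℕ} (Δ : Finset (Finset (Fin n))) : Set (Finset (Fin n)) :=
  {F | Maximal (fun G => G ∈ Δ) F}

/-- The positions at which a multi-index holds a number; `none` is the symbol `•` (or `+`). -/
def support {n : ℕ} {a : Fin n → ℕ} (i : (j : Fin n) → Option (Fin (a j))) : Finset (Fin n) :=
  Finset.univ.filter fun j => (i j).isSome = true

/-- The entries of the `J`-margins of an `a 0 × ⋯ × a (n-1)` table, for all `J ∈ Δ`: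
multi-indices with a number in the positions of some `J ∈ Δ` and `•` in all others. -/
abbrev MarginIndex {n : ℕ} (a : Fin n → ℕ) (Δ : Finset (Finset (Fin n))) : Type :=
  {i : (j : Fin n) → Option (Fin (a j)) // support i ∈ Δ}

/-- The coordinate ring `R = 𝕜[x_{i₁,…,iₙ}]` of all tables. -/
abbrev TableRing (𝕜 : Type*) [Field 𝕜] {n : ℕ} (a : Fin n → ℕ) : Type _ :=
  MvPolynomial ((j : Fin n) → Fin (a j)) 𝕜

/-- The polynomial ring `S_Δ`, with one variable for each entry of each margin in `Δ`. -/
abbrev MarginRing (𝕜 : Type*) [Field 𝕜] {n : ℕ} (a : Fin n → ℕ)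
    (Δ : Finset (Finset (Fin n))) : Type _ :=
  MvPolynomial (MarginIndex a Δ) 𝕜

/-- The marginal sum `x_σ`: the sum of the variables `x_c` over all cells `c` that agree with `σ`
wherever `σ` is a number. -/
def marginSum (𝕜 : Type*) [Field 𝕜] {n : ℕ} {a : Fin n → ℕ}
    (σ : (j : Fin n) → Option (Fin (a j))) : TableRing 𝕜 a :=
  ∑ c : (j : Fin n) → Fin (a j) with (∀ j, σ j = none ∨ σ j = some (c j)), X c

/-- `τ_Δ : S_Δ → R`, turning every `•` into `+`. -/
def tau (𝕜 : Type*) [Field 𝕜] {n : ℕ} (a : Fin n → ℕ) (Δ : Finset (Finset (Fin n))) :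
    MarginRing 𝕜 a Δ →ₐ[𝕜] TableRing 𝕜 a :=
  aeval fun i => marginSum 𝕜 i.1

/-- The Segre map `R → 𝕜[y_{j,i}]`, `x_{i₁,…,iₙ} ↦ ∏ⱼ y_{j,iⱼ}`. -/
def segre (𝕜 : Type*) [Field 𝕜] {n : ℕ} (a : Fin n → ℕ) :
    TableRing 𝕜 a →ₐ[𝕜] MvPolynomial ((j : Fin n) × Fin (a j)) 𝕜 :=
  aeval fun c => ∏ j, X ⟨j, c j⟩

/-- `σ_Δ`, the composite of `τ_Δ` and the Segre map. -/
def sigma (𝕜 : Type*) [Field 𝕜] {n : ℕ} (a : Fin n → ℕ) (Δ : Finset (Finset (Fin n))) :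
    MarginRing 𝕜 a Δ →ₐ[𝕜] MvPolynomial ((j : Fin n) × Fin (a j)) 𝕜 :=
  (segre 𝕜 a).comp (tau 𝕜 a Δ)

/-- The monomial map `η_Δ : S_Δ → 𝕜[y_{j,i}, y_{j,•}]`, `X_{i₁,…,iₙ} ↦ ∏ⱼ y_{j,iⱼ}`. -/
def eta (𝕜 : Type*) [Field 𝕜] {n : ℕ} (a : Fin n → ℕ) (Δ : Finset (Finset (Fin n))) :
    MarginRing 𝕜 a Δ →ₐ[𝕜] MvPolynomial ((j : Fin n) × Option (Fin (a j))) 𝕜 :=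
  aeval fun i => ∏ j, X ⟨j, i.1 j⟩

/-- `K_Δ = ker τ_Δ`. -/
def idealK (𝕜 : Type*) [Field 𝕜] {n : ℕ} (a : Fin n → ℕ) (Δ : Finset (Finset (Fin n))) :
    Ideal (MarginRing 𝕜 a Δ) :=
  RingHom.ker (tau 𝕜 a Δ)

/-- The toric ideal `Q_Δ = ker η_Δ`. -/
def idealQ (𝕜 : Type*) [Field 𝕜] {n : ℕ} (a : Fin n → ℕ) (Δ : Finset (Finset (Fin n))) :
    Ideal (MarginRing 𝕜 a Δ) :=
  RingHom.ker (eta 𝕜 a Δ)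

/-- `P_Δ = ker σ_Δ`. -/
def idealP (𝕜 : Type*) [Field 𝕜] {n : ℕ} (a : Fin n → ℕ) (Δ : Finset (Finset (Fin n))) :
    Ideal (MarginRing 𝕜 a Δ) :=
  RingHom.ker (sigma 𝕜 a Δ)

end

end MarginTables

/-! Let `A` be the matrix of the substitution `y_• ↦ ∑ i, y_i`, `y_i ↦ y_i`. Its Kronecker power
over the positions `j` induces `τ`, and since the Segre map is natural for such substitutions, `σ`
factors through `η` as well as through `τ`, so that `K + Q ≤ P`. If the weights `w i` sum to `1`,
then the matrix `B` of `y_i ↦ y_i + w i * (y_• - ∑ k, y_k)` satisfies `B * A = 1`, and `A * B`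
fixes `y_•`. The endomorphism induced by `A * B` on the polynomial ring in all multi-indices
therefore never turns a `•` into a number, so it preserves `S_Δ` when `Δ` is closed under subsets.
It maps `f` to some `g` with `τ g = τ f`, because `A * B * A = A`, and for which `η g` is the image
of `σ f` under the substitution `B`. If `f ∈ P`, then `f = (f - g) + g` is thus in `K + Q`. -/

namespace MarginTables

open MvPolynomial

section Substitution

variable {R m n p : Type*} [CommSemiring R] [Fintype n]

/-- The substitution `X_s ↦ ∑ t, M s t * X_t` of linear forms for the variables. -/
noncomputable def linearSubst (M : Matrix m n R) : MvPolynomial m R →ₐ[R] MvPolynomial n R :=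
  bind₁ M.toMvPolynomial

theorem linearSubst_X (M : Matrix m n R) (s : m) :
    linearSubst M (X s) = ∑ t, M s t • X t := by
  simp only [linearSubst, bind₁_X_right, Matrix.toMvPolynomial, smul_eq_C_mul,
    C_mul_X_eq_monomial]

theorem linearSubst_mul_apply [Fintype p] (M : Matrix m n R) (N : Matrix n p R)
    (f : MvPolynomial m R) : linearSubst (M * N) f = linearSubst N (linearSubst M f) := by
  have h : linearSubst (M * N) = (linearSubst N).comp (linearSubst M) :=
    algHom_ext fun s => by
      simp only [linearSubst, AlgHom.comp_apply, bind₁_X_right, Matrix.toMvPolynomial_mul]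
  rw [h, AlgHom.comp_apply]

theorem linearSubst_mem_supported {M : Matrix m n R} {u : Set m} {v : Set n}
    (hM : ∀ s ∈ u, ∀ t, M s t ≠ 0 → t ∈ v) {f : MvPolynomial m R} (hf : f ∈ supported R u) :
    linearSubst M f ∈ supported R v := by
  have hX : supported R u ≤ (supported R v).comap (linearSubst M) := by
    refine Algebra.adjoin_le ?_
    rintro _ ⟨s, hs, rfl⟩
    simp only [Subalgebra.coe_comap, Set.mem_preimage, SetLike.mem_coe, linearSubst_X]
    refine Subalgebra.sum_mem _ fun t _ => ?_
    by_cases ht : M s t = 0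
    · rw [ht, zero_smul]
      exact Subalgebra.zero_mem _
    · exact Subalgebra.smul_mem _ (Algebra.subset_adjoin (Set.mem_image_of_mem X (hM s hs t ht))) _
  exact hX hf

end Substitution

section Segre

variable {R ι : Type*} [CommSemiring R] [Fintype ι] {κ μ ν : ι → Type*}

/-- The Kronecker product of a finite family of matrices, indexed by tuples. -/
def piKronecker (M : ∀ j, Matrix (κ j) (μ j) R) : Matrix (∀ j, κ j) (∀ j, μ j) R :=
  Matrix.of fun s t => ∏ j, M j (s j) (t j)

theorem piKronecker_mul [DecidableEq ι] [∀ j, Fintype (μ j)] (M : ∀ j, Matrix (κ j) (μ j) R)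
    (N : ∀ j, Matrix (μ j) (ν j) R) :
    piKronecker M * piKronecker N = piKronecker fun j => M j * N j := by
  ext s t
  simp only [piKronecker, Matrix.mul_apply, Matrix.of_apply, Fintype.prod_sum,
    Finset.prod_mul_distrib]

variable (R κ) in
/-- The Segre map `X_s ↦ ∏ j, X_{j, s j}` for arbitrary index types. On cells it is `segre`, and
on multi-indices it is the monomial map underlying `eta`. -/
noncomputable def segreHom : MvPolynomial (∀ j, κ j) R →ₐ[R] MvPolynomial ((j : ι) × κ j) R :=
  aeval fun s => ∏ j, X ⟨j, s j⟩

theorem segreHom_X (s : ∀ j, κ j) : segreHom R κ (X s) = ∏ j, X ⟨j, s j⟩ :=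
  aeval_X _ s

theorem linearSubst_blockDiagonal'_X [DecidableEq ι] [∀ j, Fintype (μ j)]
    (M : ∀ j, Matrix (κ j) (μ j) R) (j : ι) (s : κ j) :
    linearSubst (Matrix.blockDiagonal' M) (X ⟨j, s⟩) = ∑ t, M j s t • X ⟨j, t⟩ := by
  rw [linearSubst_X, Fintype.sum_sigma, Fintype.sum_eq_single j]
  · simp only [Matrix.blockDiagonal'_apply_eq]
  · intro k hk
    simp only [Matrix.blockDiagonal'_apply_ne _ _ _ hk.symm, zero_smul, Finset.sum_const_zero]

theorem segreHom_linearSubst_piKronecker [DecidableEq ι] [∀ j, Fintype (μ j)]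
    (M : ∀ j, Matrix (κ j) (μ j) R) (f : MvPolynomial (∀ j, κ j) R) :
    segreHom R μ (linearSubst (piKronecker M) f) =
      linearSubst (Matrix.blockDiagonal' M) (segreHom R κ f) := by
  have h : (segreHom R μ).comp (linearSubst (piKronecker M)) =
      (linearSubst (Matrix.blockDiagonal' M)).comp (segreHom R κ) := by
    refine algHom_ext fun s => ?_
    calc segreHom R μ (linearSubst (piKronecker M) (X s))
        = ∑ t : ∀ j, μ j, (∏ j, M j (s j) (t j)) • ∏ j, X ⟨j, t j⟩ := by
          simp only [linearSubst_X, map_sum, map_smul, segreHom_X, piKronecker, Matrix.of_apply]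
      _ = ∏ j, ∑ t, M j (s j) t • X ⟨j, t⟩ := by
          simp only [Fintype.prod_sum, Algebra.smul_def, Finset.prod_mul_distrib, map_prod]
      _ = linearSubst (Matrix.blockDiagonal' M) (segreHom R κ (X s)) := by
          simp only [segreHom_X, map_prod, linearSubst_blockDiagonal'_X]
  exact DFunLike.congr_fun h f

end Segre

section MarginMatrix

variable (R κ : Type*) [CommRing R] [DecidableEq κ]

/-- The matrix of the substitution `y_• ↦ ∑ i, y_i`, `y_i ↦ y_i`; the symbol `•` is `none`. -/
def marginMatrix : Matrix (Option κ) κ R :=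
  Matrix.of fun s c => if s = none ∨ s = some c then 1 else 0

variable {R κ}

/-- The matrix of the substitution `y_i ↦ y_i + w i * (y_• - ∑ k, y_k)`, which distributes the
discrepancy between `y_•` and the sum of the `y_k` according to the weights `w`. -/
def marginSection (w : κ → R) : Matrix κ (Option κ) R :=
  Matrix.of fun i t => t.elim (w i) fun k => (1 : Matrix κ κ R) i k - w i

variable [Fintype κ]

theorem marginSection_mul_marginMatrix (w : κ → R) :
    marginSection w * marginMatrix R κ = 1 := by
  ext i c
  simp [Matrix.mul_apply, Fintype.sum_option, marginSection, marginMatrix, Matrix.one_apply]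

theorem marginMatrix_mul_marginSection_none_some {w : κ → R} (hw : ∑ i, w i = 1) (k : κ) :
    (marginMatrix R κ * marginSection w) none (some k) = 0 := by
  simp [Matrix.mul_apply, marginSection, marginMatrix, Matrix.one_apply, hw]

variable (R κ) in
theorem exists_marginMatrix_leftInverse :
    ∃ B : Matrix κ (Option κ) R,
      B * marginMatrix R κ = 1 ∧ ∀ k, (marginMatrix R κ * B) none (some k) = 0 := by
  rcases isEmpty_or_nonempty κ with _ | ⟨⟨z⟩⟩
  · exact ⟨0, Subsingleton.elim _ _, isEmptyElim⟩
  · exact ⟨marginSection (Pi.single z 1), marginSection_mul_marginMatrix _,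
      marginMatrix_mul_marginSection_none_some (by simp)⟩

end MarginMatrix

section Support

variable {R : Type*} [CommSemiring R] {n : ℕ} {a : Fin n → ℕ}

theorem support_subset_of_piKronecker_ne_zero
    {E : ∀ j, Matrix (Option (Fin (a j))) (Option (Fin (a j))) R}
    (hE : ∀ j k, E j none (some k) = 0) {s t : ∀ j, Option (Fin (a j))}
    (hst : piKronecker E s t ≠ 0) : support t ⊆ support s := by
  intro j ht
  simp only [support, Finset.mem_filter, Finset.mem_univ, true_and] at ht ⊢
  obtain ⟨k, hk⟩ := Option.isSome_iff_exists.1 ht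
  by_contra hs
  rw [Bool.not_eq_true, Option.isSome_eq_false_iff, Option.isNone_iff_eq_none] at hs
  exact hst (Finset.prod_eq_zero (Finset.mem_univ j) (by rw [hs, hk, hE]))

theorem exists_rename_eq_linearSubst_piKronecker {Δ : Finset (Finset (Fin n))}
    (hΔ : IsLowerSet (Δ : Set (Finset (Fin n))))
    {E : ∀ j, Matrix (Option (Fin (a j))) (Option (Fin (a j))) R}
    (hE : ∀ j k, E j none (some k) = 0) (f : MvPolynomial (MarginIndex a Δ) R) :
    ∃ g : MvPolynomial (MarginIndex a Δ) R,
      rename Subtype.val g = linearSubst (piKronecker E) (rename Subtype.val f) := by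
  let faces : Set (∀ j, Option (Fin (a j))) := {s | support s ∈ Δ}
  have hf : rename Subtype.val f ∈ supported R faces := by
    rw [supported_eq_range_rename]
    exact ⟨f, rfl⟩
  have hfaces : ∀ s ∈ faces, ∀ t, piKronecker E s t ≠ 0 → t ∈ faces := fun s hs t hst =>
    hΔ (support_subset_of_piKronecker_ne_zero hE hst) hs
  have hmem := linearSubst_mem_supported hfaces hf
  rwa [supported_eq_range_rename] at hmem

end Support

section Ideals

variable (𝕜 : Type*) [Field 𝕜] {n : ℕ} {a : Fin n → ℕ} {Δ : Finset (Finset (Fin n))}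

theorem marginSum_eq_linearSubst_X (s : ∀ j, Option (Fin (a j))) :
    marginSum 𝕜 s = linearSubst (piKronecker fun j => marginMatrix 𝕜 (Fin (a j))) (X s) := by
  simp only [linearSubst_X, piKronecker, Matrix.of_apply, marginMatrix,
    Fintype.prod_ite_zero, Finset.prod_const_one, ite_smul, one_smul, zero_smul, marginSum,
    Finset.sum_filter]

theorem tau_apply (f : MarginRing 𝕜 a Δ) :
    tau 𝕜 a Δ f =
      linearSubst (piKronecker fun j => marginMatrix 𝕜 (Fin (a j))) (rename Subtype.val f) := by
  have h : tau 𝕜 a Δ =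
      (linearSubst (piKronecker fun j => marginMatrix 𝕜 (Fin (a j)))).comp
        (rename Subtype.val) :=
    algHom_ext fun s => by
      simp only [tau, aeval_X, AlgHom.comp_apply, rename_X, marginSum_eq_linearSubst_X]
  rw [h, AlgHom.comp_apply]

theorem eta_apply (f : MarginRing 𝕜 a Δ) :
    eta 𝕜 a Δ f = segreHom 𝕜 (fun j => Option (Fin (a j))) (rename Subtype.val f) := by
  rw [segreHom, aeval_rename]
  rfl

theorem sigma_apply (f : MarginRing 𝕜 a Δ) :
    sigma 𝕜 a Δ f =
      linearSubst (Matrix.blockDiagonal' fun j => marginMatrix 𝕜 (Fin (a j))) (eta 𝕜 a Δ f) := by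
  rw [eta_apply, ← segreHom_linearSubst_piKronecker, ← tau_apply]
  rfl

theorem idealK_le_idealP : idealK 𝕜 a Δ ≤ idealP 𝕜 a Δ := fun f (hf : tau 𝕜 a Δ f = 0) => by
  rw [idealP, RingHom.mem_ker, sigma, AlgHom.comp_apply, hf, map_zero]

theorem idealQ_le_idealP : idealQ 𝕜 a Δ ≤ idealP 𝕜 a Δ := fun f (hf : eta 𝕜 a Δ f = 0) => by
  rw [idealP, RingHom.mem_ker, sigma_apply, hf, map_zero]

theorem exists_tau_eq_eta_eq_zero_of_sigma_eq_zero (hΔ : IsLowerSet (Δ : Set (Finset (Fin n))))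
    {f : MarginRing 𝕜 a Δ} (hf : sigma 𝕜 a Δ f = 0) :
    ∃ g : MarginRing 𝕜 a Δ, tau 𝕜 a Δ g = tau 𝕜 a Δ f ∧ eta 𝕜 a Δ g = 0 := by
  let A := fun j => marginMatrix 𝕜 (Fin (a j))
  choose B hBA hAB using fun j => exists_marginMatrix_leftInverse 𝕜 (Fin (a j))
  obtain ⟨g, hg⟩ := exists_rename_eq_linearSubst_piKronecker hΔ hAB f
  have hABA : (fun j => A j * B j * A j) = A :=
    funext fun j => by rw [Matrix.mul_assoc, hBA, Matrix.mul_one]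
  refine ⟨g, ?_, ?_⟩
  · rw [tau_apply, hg, ← linearSubst_mul_apply, piKronecker_mul, hABA, tau_apply]
  · rw [eta_apply, hg, segreHom_linearSubst_piKronecker, ← eta_apply, Matrix.blockDiagonal'_mul,
      linearSubst_mul_apply, ← sigma_apply, hf, map_zero]

theorem idealK_add_idealQ_eq_idealP (hΔ : IsLowerSet (Δ : Set (Finset (Fin n)))) :
    idealK 𝕜 a Δ + idealQ 𝕜 a Δ = idealP 𝕜 a Δ := by
  refine le_antisymm (sup_le (idealK_le_idealP 𝕜) (idealQ_le_idealP 𝕜)) fun f hf => ?_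
  obtain ⟨g, hτ, hη⟩ := exists_tau_eq_eta_eq_zero_of_sigma_eq_zero 𝕜 hΔ hf
  have hK : f - g ∈ idealK 𝕜 a Δ := by
    rw [idealK, RingHom.mem_ker, map_sub, hτ, sub_self]
  exact Submodule.mem_sup.2 ⟨f - g, hK, g, hη, sub_add_cancel f g⟩

end Ideals

end MarginTables

theorem mainTheorem4_general (𝕜 : Type*) [Field 𝕜] (n : ℕ) (a : Fin n → ℕ)
    (Δ : Finset (Finset (Fin n))) (hΔ : IsLowerSet (Δ : Set (Finset (Fin n)))) :
    (MarginTables.idealK 𝕜 a Δ + MarginTables.idealQ 𝕜 a Δ).IsRadical ∧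
      MarginTables.idealK 𝕜 a Δ + MarginTables.idealQ 𝕜 a Δ = MarginTables.idealP 𝕜 a Δ ∧
      (MarginTables.idealP 𝕜 a Δ).IsPrime := by
  have hsum := MarginTables.idealK_add_idealQ_eq_idealP 𝕜 (a := a) hΔ
  have hprime : (MarginTables.idealP 𝕜 a Δ).IsPrime := RingHom.ker_isPrime _
  exact ⟨hsum ▸ hprime.isRadical, hsum, hprime⟩

theorem mainTheorem4 (𝕜 : Type*) [Field 𝕜] (n : ℕ) (a : Fin n → ℕ)
    (Δ : Finset (Finset (Fin n))) (hΔ : IsLowerSet (Δ : Set (Finset (Fin n))))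
    (hfacets : (MarginTables.facets Δ).ncard ≤ 3) :
    (MarginTables.idealK 𝕜 a Δ + MarginTables.idealQ 𝕜 a Δ).IsRadical ∧
      MarginTables.idealK 𝕜 a Δ + MarginTables.idealQ 𝕜 a Δ = MarginTables.idealP 𝕜 a Δ ∧
      (MarginTables.idealP 𝕜 a Δ).IsPrime :=
  mainTheorem4_general 𝕜 n a Δ hΔ
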